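/- Let $d\ge 1$, let $p_0:\mathbb R^d\to[0,\infty)$ be a probability density with respect to Lebesgue measure, and write $\widehat{p_0}(s)=\int_{\mathbb R^d}e^{i s^\top y}p_0(y)\,dy$. Assume that $p_0$ is upper-supersmooth of order $\alpha>0$, that is, for some constants $K$ and $C_1>0$, $$|\widehat{p_0}(s)|\le K\exp\Big(-C_1\sum_{j=1}^d|s_j|^\alpha\Big)\qquad\text{for all } s\in\mathbb R^d .$$ Let $\mathcal X\subset\mathbb R^d$ be a bounded set contained in the closure of its interior (for instance a bounded open set or a closed ball), and assume that $p_0$ is continuously differentiable on $\mathcal X$. Let $X_1,X_2,\dots$ be i.i.d. random vectors with density $p_0$, $X_i=(X_{i1},\dots,X_{id})$, and for $R>0$ let $$\widehat f_{n,R}(x)=\frac1{n\pi^d}\sum_{i=1}^n\prod_{j=1}^d\frac{\sin(R(x_j-X_{ij}))}{x_j-X_{ij}}$$ be the Fourier density estimator (a factor is read as $R$ when $x_j=X_{ij}$). Let $C$ be any constant with $C>\frac1{2C_1}$; if $1-\alpha<d/2$, then $C=\frac1{2C_1}$ is allowed as well. For $n\ge 2$ let $R=R_n>0$ be given by $R^\alpha=C\log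 n$. Then for every $x\in\mathcal X$, as $n\to\infty$: (1) $\displaystyle \sqrt{\frac{n}{R^d}}\,\big(\widehat f_{n,R}(x)-p_0(x)\big)\xrightarrow{\;d\;}\mathcal N\Big(0,\frac{p_0(x)}{\pi^d}\Big)$, where $\mathcal N(0,0)$ is the point mass at $0$. (2) If moreover $p_0(x)>0$, then for every $\tau\in(0,1)$, with $z_{1-\tau/2}$ the $(1-\tau/2)$-quantile of $\mathcal N(0,1)$, each of the intervals $$\widehat f_{n,R}(x)\pm z_{1-\tau/2}\sqrt{\frac{R^d\,p_0(x)}{n\pi^d}},\qquad \widehat f_{n,R}(x)\pm z_{1-\tau/2}\sqrt{\frac{R^d\max\{\widehat f_{n,R}(x),0\}}{n\pi^d}}$$ contains $p_0(x)$ with probability tending to $1-\tau$. -/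

import Mathlib

open MeasureTheory ProbabilityTheory Filter Topology

noncomputable section

/-- `p` is a probability density on `ℝ^d` with respect to Lebesgue measure. -/
structure IsProbDensity {d : ℕ} (p : EuclideanSpace ℝ (Fin d) → ℝ) : Prop where
  measurable : Measurable p
  nonneg : ∀ x, 0 ≤ p x
  integrable : Integrable p
  integral_eq_one : ∫ x, p x = 1

/-- The Fourier transform `s ↦ ∫ exp (i sᵀx) p(x) dx` of `p`, in the angular-frequency
normalisation used in probability theory. -/
def densityFourier {d : ℕ} (p : EuclideanSpace ℝ (Fin d) → ℝ)
    (s : EuclideanSpace ℝ (Fin d)) : ℂ :=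
  ∫ x : EuclideanSpace ℝ (Fin d),
    Complex.exp (Complex.I * ((∑ j, s j * x j : ℝ) : ℂ)) * ((p x : ℝ) : ℂ)

/-- The upper-supersmoothness inequality of order `α` with the constants `K` and `C₁ > 0`:
`|p̂(s)| ≤ K exp (-C₁ ∑ⱼ |sⱼ|^α)` for all `s`. The density `p` is upper-supersmooth of order `α`
when this holds for some `K` and some `C₁ > 0`. -/
def UpperSupersmoothWith {d : ℕ} (p : EuclideanSpace ℝ (Fin d) → ℝ) (α K C₁ : ℝ) : Prop :=
  0 < C₁ ∧ ∀ s : EuclideanSpace ℝ (Fin d),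
    ‖densityFourier p s‖ ≤ K * Real.exp (-C₁ * ∑ j, |s j| ^ α)

/-- The one-dimensional Fourier kernel `sin (R u) / u`, with its continuous value `R` at `u = 0`. -/
def fourierKernel (R u : ℝ) : ℝ :=
  if u = 0 then R else Real.sin (R * u) / u

/-- The Fourier density estimator at `x` with radius `R`, from the sample `X₀, …, Xₙ₋₁`:
`(1 / (n π^d)) ∑ᵢ ∏ⱼ sin (R (xⱼ - Xᵢⱼ)) / (xⱼ - Xᵢⱼ)`. -/
def fourierEstimator {d : ℕ} {Ω : Type*} (X : ℕ → Ω → EuclideanSpace ℝ (Fin d))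
    (n : ℕ) (R : ℝ) (x : EuclideanSpace ℝ (Fin d)) (ω : Ω) : ℝ :=
  1 / ((n : ℝ) * Real.pi ^ d) *
    ∑ i ∈ Finset.range n, ∏ j, fourierKernel R (x j - X i ω j)

/-- The interval `m ± z √(R^d v / (n π^d))`, with centre `m`, critical value `z`
and `v` standing for the value of the density. -/
def fourierInterval (d n : ℕ) (R z m v : ℝ) : Set ℝ :=
  Set.Icc (m - z * Real.sqrt (R ^ d * v / ((n : ℝ) * Real.pi ^ d)))
    (m + z * Real.sqrt (R ^ d * v / ((n : ℝ) * Real.pi ^ d)))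

end

/-!
The kernel `sin (R u) / u` and its square divided by `R` are Fourier transforms of a box and of a
tent, both of which tend to the constant `1/2` as `R → ∞`. The first two moments of the product
kernel under the law of `X₁ - x` are thus integrals of the characteristic function against products
of these weights, and dominated convergence with Fourier inversion gives a variance asymptotic to
`R^d π^d p₀(x)`. The kernel is bounded by `R^d = o(n)`, so Taylor expansion of the characteristic
function yields a central limit theorem for the triangular array of centred summands.

The bias is the mass of the characteristic function outside `[-R, R]^d`. Supersmoothness reduces it
to the tail `∫_R^∞ exp (-C₁ u^α) du`, which is of order `R^(1-α) exp (-C₁ R^α)`, while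
`√(n / R^d) = exp (R^α / (2C)) R^(-d/2)`: the product tends to `0` precisely under the condition on
`C`. The coverage statements then follow from Slutsky's lemma and the portmanteau theorem.
-/

open scoped NNReal Real InnerProductSpace

section TriangularArray

lemma norm_exp_mul_I_sub_taylor_le {u : ℝ} (hu : |u| ≤ 1) :
    ‖Complex.exp (u * Complex.I) - (1 + u * Complex.I - (u : ℂ) ^ 2 / 2)‖ ≤ |u| ^ 3 := by
  have hnorm : ‖(u * Complex.I : ℂ)‖ = |u| := by simp
  have hsum : ∑ m ∈ Finset.range 3, (u * Complex.I : ℂ) ^ m / (m.factorial : ℂ)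
      = 1 + u * Complex.I - (u : ℂ) ^ 2 / 2 := by
    simp [Finset.sum_range_succ, mul_pow, Nat.factorial]
    ring
  have h := Complex.exp_bound (x := u * Complex.I) (hnorm.trans_le hu) (n := 3) (by norm_num)
  rw [hnorm, hsum] at h
  refine h.trans (mul_le_of_le_one_right (by positivity) ?_)
  norm_num [Nat.factorial]

lemma norm_charFun_sub_taylor_le {ν : Measure ℝ} [IsProbabilityMeasure ν] {B t : ℝ}
    (hB : ∀ᵐ y ∂ν, |y| ≤ B) (hmean : ∫ y, y ∂ν = 0) (ht : |t| * B ≤ 1) :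
    ‖charFun ν t - (1 - (t : ℂ) ^ 2 / 2 * (∫ y, y ^ 2 ∂ν : ℝ))‖
      ≤ |t| ^ 3 * B * ∫ y, y ^ 2 ∂ν := by
  have hint : Integrable (fun y : ℝ => (y : ℂ)) ν :=
    (Integrable.of_bound aestronglyMeasurable_id B hB).ofReal
  have hint_sq : Integrable (fun y : ℝ => y ^ 2) ν :=
    .of_bound (by fun_prop) (B ^ 2) (hB.mono fun y hy => by
      simpa using sq_le_sq' (neg_le_of_abs_le hy) (le_of_abs_le hy))
  have hint_exp : Integrable (fun y : ℝ => Complex.exp (t * y * Complex.I)) ν :=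
    .of_bound (by fun_prop) 1 (.of_forall fun y => by
      rw [← Complex.ofReal_mul, Complex.norm_exp_ofReal_mul_I])
  have hint_linear : Integrable (fun y : ℝ => (1 : ℂ) + t * Complex.I * y) ν :=
    (integrable_const _).add (hint.const_mul _)
  have hint_quad : Integrable (fun y : ℝ => (t : ℂ) ^ 2 / 2 * (y ^ 2 : ℝ)) ν :=
    hint_sq.ofReal.const_mul _
  have hint_taylor : Integrable
      (fun y : ℝ => (1 : ℂ) + t * Complex.I * y - (t : ℂ) ^ 2 / 2 * (y ^ 2 : ℝ)) ν :=
    hint_linear.sub hint_quad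
  have htaylor : ∫ y : ℝ, ((1 : ℂ) + t * Complex.I * y - (t : ℂ) ^ 2 / 2 * (y ^ 2 : ℝ)) ∂ν
      = 1 - (t : ℂ) ^ 2 / 2 * (∫ y, y ^ 2 ∂ν : ℝ) := by
    rw [integral_sub hint_linear hint_quad, integral_add (integrable_const _) (hint.const_mul _),
      integral_const_mul, integral_const_mul, integral_complex_ofReal, integral_complex_ofReal,
      hmean]
    simp
  rw [charFun_apply_real, ← htaylor, ← integral_sub hint_exp hint_taylor, ← integral_const_mul]
  refine norm_integral_le_of_norm_le (hint_sq.const_mul _) (hB.mono fun y hy => ?_)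
  have hty : |t * y| ≤ 1 :=
    (abs_mul t y).trans_le ((mul_le_mul_of_nonneg_left hy (abs_nonneg t)).trans ht)
  calc ‖Complex.exp (t * y * Complex.I)
        - (1 + t * Complex.I * y - (t : ℂ) ^ 2 / 2 * (y ^ 2 : ℝ))‖
      = ‖Complex.exp ((t * y : ℝ) * Complex.I)
        - (1 + (t * y : ℝ) * Complex.I - ((t * y : ℝ) : ℂ) ^ 2 / 2)‖ := by
        push_cast; ring_nf
    _ ≤ |t * y| ^ 3 := norm_exp_mul_I_sub_taylor_le hty
    _ = |t| ^ 3 * |y| * y ^ 2 := by rw [abs_mul, ← sq_abs y]; ring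
    _ ≤ |t| ^ 3 * B * y ^ 2 := by gcongr

lemma norm_natCast_mul_charFun_sub_one_add_le {ν : Measure ℝ} [IsProbabilityMeasure ν] {B t : ℝ}
    (hB : ∀ᵐ y ∂ν, |y| ≤ B) (hmean : ∫ y, y ∂ν = 0) {n : ℕ} (hn : 0 < n)
    (ht : |t| * (B / √n) ≤ 1) :
    ‖(n : ℂ) * (charFun ν ((√n)⁻¹ * t) - 1) + (t : ℂ) ^ 2 / 2 * (∫ y, y ^ 2 ∂ν : ℝ)‖
      ≤ |t| ^ 3 * (B / √n) * ∫ y, y ^ 2 ∂ν := by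
  have hsqrt : 0 < √(n : ℝ) := by positivity
  have hn' : (n : ℂ) ≠ 0 := by exact_mod_cast hn.ne'
  have habs : |(√n)⁻¹ * t| = |t| / √n := by
    rw [abs_mul, abs_of_pos (inv_pos.2 hsqrt), mul_comm, div_eq_mul_inv]
  have hsq : ((√n : ℝ) : ℂ) ^ 2 = n := by
    rw [← Complex.ofReal_pow, Real.sq_sqrt n.cast_nonneg, Complex.ofReal_natCast]
  have htaylor := norm_charFun_sub_taylor_le hB hmean (t := (√n)⁻¹ * t) (by
    rw [habs, div_mul_eq_mul_div, mul_div_assoc]; exact ht)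
  calc _ = ‖(n : ℂ) * (charFun ν ((√n)⁻¹ * t)
          - (1 - (((√n)⁻¹ * t : ℝ) : ℂ) ^ 2 / 2 * (∫ y, y ^ 2 ∂ν : ℝ)))‖ := by
        congr 1
        push_cast
        rw [mul_pow, inv_pow, hsq]
        field_simp
        ring
    _ ≤ n * ((|t| / √n) ^ 3 * B * ∫ y, y ^ 2 ∂ν) := by
        rw [norm_mul, Complex.norm_natCast, ← habs]
        gcongr
    _ = √n ^ 2 * ((|t| / √n) ^ 3 * B * ∫ y, y ^ 2 ∂ν) := by rw [Real.sq_sqrt n.cast_nonneg]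
    _ = |t| ^ 3 * (B / √n) * ∫ y, y ^ 2 ∂ν := by field

lemma tendsto_charFun_inv_sqrt_mul_pow_exp {ν : ℕ → Measure ℝ} [∀ n, IsProbabilityMeasure (ν n)]
    {B : ℕ → ℝ} (hB : ∀ n, ∀ᵐ y ∂ν n, |y| ≤ B n)
    (hB0 : Tendsto (fun n : ℕ => B n / √n) atTop (𝓝 0)) (hmean : ∀ n, ∫ y, y ∂ν n = 0)
    {v : ℝ} (hv : Tendsto (fun n => ∫ y, y ^ 2 ∂ν n) atTop (𝓝 v)) (t : ℝ) :
    Tendsto (fun n : ℕ => charFun (ν n) ((√n)⁻¹ * t) ^ n) atTop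
      (𝓝 (Complex.exp (-(v * (t : ℂ) ^ 2 / 2)))) := by
  have hexponent : Tendsto (fun n => (t : ℂ) ^ 2 / 2 * (∫ y, y ^ 2 ∂ν n : ℝ)) atTop
      (𝓝 ((t : ℂ) ^ 2 / 2 * v)) :=
    ((Complex.continuous_ofReal.tendsto v).comp hv).const_mul _
  have hremainder : Tendsto (fun n : ℕ => (n : ℂ) * (charFun (ν n) ((√n)⁻¹ * t) - 1)
      + (t : ℂ) ^ 2 / 2 * (∫ y, y ^ 2 ∂ν n : ℝ)) atTop (𝓝 0) := by
    have hbound : Tendsto (fun n : ℕ => |t| ^ 3 * (B n / √n) * ∫ y, y ^ 2 ∂ν n) atTop (𝓝 0) := by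
      simpa using (hB0.const_mul (|t| ^ 3)).mul hv
    have hsmall : ∀ᶠ n : ℕ in atTop, |t| * (B n / √n) < 1 :=
      (hB0.const_mul |t|).eventually_lt_const (by simp)
    refine squeeze_zero_norm' ?_ hbound
    filter_upwards [hsmall, eventually_gt_atTop 0] with n ht hn
    exact norm_natCast_mul_charFun_sub_one_add_le (hB n) (hmean n) hn ht.le
  have hmain : Tendsto (fun n : ℕ => (n : ℂ) * (charFun (ν n) ((√n)⁻¹ * t) - 1)) atTop
      (𝓝 (-((t : ℂ) ^ 2 / 2 * v))) := by
    simpa using hremainder.sub hexponent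
  simpa [mul_div_assoc, mul_comm] using Complex.tendsto_one_add_pow_exp_of_tendsto hmain

variable {Ω Ω' : Type*} [MeasurableSpace Ω] [MeasurableSpace Ω'] {P : Measure Ω} {P' : Measure Ω'}
  [IsProbabilityMeasure P] [IsProbabilityMeasure P'] {Y : ℕ → ℕ → Ω → ℝ} {Z : Ω' → ℝ}
  {B : ℕ → ℝ} {v : ℝ≥0}

lemma tendstoInDistribution_inv_sqrt_mul_sum_array_of_centered
    (hZ : HasLaw Z (gaussianReal 0 v) P') (hindep : ∀ n, iIndepFun (Y n) P)
    (hident : ∀ n i, IdentDistrib (Y n i) (Y n 0) P P) (hB : ∀ n, ∀ᵐ ω ∂P, |Y n 0 ω| ≤ B n)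
    (hB0 : Tendsto (fun n : ℕ => B n / √n) atTop (𝓝 0)) (hmean : ∀ n, P[Y n 0] = 0)
    (hv : Tendsto (fun n => Var[Y n 0; P]) atTop (𝓝 v)) :
    TendstoInDistribution (fun (n : ℕ) ω => (√n)⁻¹ * ∑ i ∈ Finset.range n, Y n i ω) atTop Z
      (fun _ => P) P' where
  forall_aemeasurable n :=
    .const_mul (Finset.aemeasurable_fun_sum _ fun i _ => (hident n i).aemeasurable_fst) _
  tendsto := by
    have hY n := (hident n 0).aemeasurable_fst
    have (n : ℕ) : IsProbabilityMeasure (P.map (Y n 0)) := Measure.isProbabilityMeasure_map (hY n)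
    have hv' : Tendsto (fun n => ∫ y, y ^ 2 ∂P.map (Y n 0)) atTop (𝓝 (v : ℝ)) := by
      refine hv.congr fun n => ?_
      rw [variance_of_integral_eq_zero (hY n) (hmean n), integral_map (hY n) (by fun_prop)]
    refine ProbabilityMeasure.tendsto_iff_tendsto_charFun.2 fun t => ?_
    rw! [hZ.map_eq]
    have hB' n : ∀ᵐ y ∂P.map (Y n 0), |y| ≤ B n :=
      (ae_map_iff (hY n) (measurableSet_le measurable_norm measurable_const)).2 (hB n)
    have hmean' n : ∫ y, y ∂P.map (Y n 0) = 0 :=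
      (integral_map (hY n) aestronglyMeasurable_id).trans (hmean n)
    simpa [charFun_inv_sqrt_mul_sum (hindep _) (hident _), charFun_gaussianReal]
      using tendsto_charFun_inv_sqrt_mul_pow_exp hB' hB0 hmean' hv' t

theorem tendstoInDistribution_inv_sqrt_mul_sum_array
    (hZ : HasLaw Z (gaussianReal 0 v) P') (hindep : ∀ n, iIndepFun (Y n) P)
    (hident : ∀ n i, IdentDistrib (Y n i) (Y n 0) P P) (hB : ∀ n, ∀ᵐ ω ∂P, |Y n 0 ω| ≤ B n)
    (hB0 : Tendsto (fun n : ℕ => B n / √n) atTop (𝓝 0))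
    (hv : Tendsto (fun n => Var[Y n 0; P]) atTop (𝓝 v)) :
    TendstoInDistribution
      (fun (n : ℕ) ω => (√n)⁻¹ * (∑ i ∈ Finset.range n, Y n i ω - n * P[Y n 0])) atTop Z
      (fun _ => P) P' := by
  have hY n := (hident n 0).aemeasurable_fst
  have hint n : Integrable (Y n 0) P := .of_bound (hY n).aestronglyMeasurable (B n) (hB n)
  set m : ℕ → ℝ := fun n => P[Y n 0] with hm
  have hm_le n : |m n| ≤ B n := by
    simpa using norm_integral_le_of_norm_le_const (f := Y n 0) (hB n)
  have hcentered := tendstoInDistribution_inv_sqrt_mul_sum_array_of_centered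
    (Y := fun n i ω => Y n i ω - m n) (B := fun n => 2 * B n) hZ
    (fun n => (hindep n).comp (fun _ y => y - m n) fun _ => by fun_prop)
    (fun n i => (hident n i).comp (u := fun y => y - m n) (by fun_prop))
    (fun n => (hB n).mono fun ω hω => by linarith [abs_sub (Y n 0 ω) (m n), hm_le n])
    (by simpa [mul_div_assoc] using hB0.const_mul 2)
    (fun n => by simp [integral_sub (hint n) (integrable_const _), hm])
    (hv.congr fun n => (variance_sub_const (hY n).aestronglyMeasurable _).symm)
  simpa [Finset.sum_sub_distrib] using hcentered

end TriangularArray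

section ProductWeights

variable {ι : Type*} [Fintype ι]

lemma integral_euclideanSpace_prod {𝕜 : Type*} [RCLike 𝕜] (f : ι → ℝ → 𝕜) :
    ∫ s : EuclideanSpace ℝ ι, ∏ j, f j (s j) = ∏ j, ∫ u, f j u := by
  rw [← integral_fintype_prod_volume_eq_prod f]
  exact (EuclideanSpace.volume_preserving_symm_measurableEquiv_toLp ι).integral_comp'
    (fun y : ι → ℝ => ∏ j, f j (y j))

lemma integrable_euclideanSpace_prod {𝕜 : Type*} [RCLike 𝕜] {f : ι → ℝ → 𝕜}
    (hf : ∀ j, Integrable (f j)) :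
    Integrable fun s : EuclideanSpace ℝ ι => ∏ j, f j (s j) :=
  ((EuclideanSpace.volume_preserving_symm_measurableEquiv_toLp ι).integrable_comp_emb
    (MeasurableEquiv.measurableEmbedding _)).2 (Integrable.fintype_prod hf)

variable {ν : Measure (EuclideanSpace ℝ ι)} [IsFiniteMeasure ν]

lemma integral_prod_mul_charFun {a : ℝ → ℂ} (ha : Integrable a) :
    ∫ s : EuclideanSpace ℝ ι, (∏ j, a (s j)) * charFun ν s
      = ∫ y, (∏ j, ∫ t : ℝ, a t * Complex.exp (t * y j * Complex.I)) ∂ν := by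
  have hexp (y s : EuclideanSpace ℝ ι) :
      Complex.exp (⟪y, s⟫_ℝ * Complex.I) = ∏ j, Complex.exp (s j * y j * Complex.I) := by
    rw [← Complex.exp_sum, ← Finset.sum_mul]
    simp [PiLp.inner_apply]
  have hint : Integrable (Function.uncurry fun s y : EuclideanSpace ℝ ι =>
      (∏ j, a (s j)) * Complex.exp (⟪y, s⟫_ℝ * Complex.I)) (volume.prod ν) :=
    ((integrable_euclideanSpace_prod fun _ => ha).comp_fst ν).mul_bdd (c := 1) (by fun_prop)
      (.of_forall fun _ => by rw [Complex.norm_exp_ofReal_mul_I])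
  calc _ = ∫ s : EuclideanSpace ℝ ι,
        ∫ y, (∏ j, a (s j)) * Complex.exp (⟪y, s⟫_ℝ * Complex.I) ∂ν := by
        simp only [charFun_apply, integral_const_mul]
    _ = ∫ y, (∫ s : EuclideanSpace ℝ ι,
        (∏ j, a (s j)) * Complex.exp (⟪y, s⟫_ℝ * Complex.I)) ∂ν := integral_integral_swap hint
    _ = _ := by
        simp only [hexp, ← Finset.prod_mul_distrib]
        congr 1 with y
        exact integral_euclideanSpace_prod fun j t => a t * Complex.exp (t * y j * Complex.I)

lemma tendsto_integral_prod_of_charFun_integrable (hν : Integrable (charFun ν)) {κ : Type*}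
    {l : Filter κ} [l.IsCountablyGenerated] {a k : κ → ℝ → ℝ} {c : ℝ}
    (ha : ∀ᶠ r in l, Integrable (a r)) (hac : ∀ᶠ r in l, ∀ t, |a r t| ≤ c)
    (hlim : ∀ t, Tendsto (fun r => a r t) l (𝓝 c))
    (hk : ∀ᶠ r in l, ∀ u : ℝ, ∫ t : ℝ, (a r t : ℂ) * Complex.exp (t * u * Complex.I) = k r u) :
    Tendsto (fun r => ∫ y, ∏ j, k r (y j) ∂ν) l
      (𝓝 (c ^ Fintype.card ι * (∫ s, charFun ν s).re)) := by
  suffices h : Tendsto (fun r => ((∫ y, ∏ j, k r (y j) ∂ν : ℝ) : ℂ)) l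
      (𝓝 (((c ^ Fintype.card ι : ℝ) : ℂ) * ∫ s, charFun ν s)) by
    simpa only [Function.comp_def, Complex.ofReal_re, Complex.re_ofReal_mul]
      using (Complex.continuous_re.tendsto _).comp h
  rw [Complex.ofReal_pow, ← integral_const_mul]
  have hparseval : ∀ᶠ r in l, ∫ s : EuclideanSpace ℝ ι, (∏ j, (a r (s j) : ℂ)) * charFun ν s
      = (∫ y, ∏ j, k r (y j) ∂ν : ℝ) := by
    filter_upwards [ha, hk] with r har hkr
    have har' : Integrable fun t => (a r t : ℂ) := har.ofReal
    rw [integral_prod_mul_charFun har', ← integral_complex_ofReal]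
    simp [hkr]
  refine Tendsto.congr' hparseval (tendsto_integral_filter_of_dominated_convergence
    (fun s => c ^ Fintype.card ι * ‖charFun ν s‖) ?_ ?_ (hν.norm.const_mul _) ?_)
  · filter_upwards [ha] with r har
    exact (integrable_euclideanSpace_prod fun _ => har.ofReal).aestronglyMeasurable.mul
      hν.aestronglyMeasurable
  · filter_upwards [hac] with r hr
    refine .of_forall fun s => ?_
    rw [norm_mul, norm_prod, ← Finset.card_univ, ← Finset.prod_const]
    gcongr with j
    simpa using hr (s j)
  · refine .of_forall fun s => Tendsto.mul_const _ ?_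
    rw [← Finset.card_univ, ← Finset.prod_const]
    exact tendsto_finsetProd _ fun j _ => (Complex.continuous_ofReal.tendsto c).comp (hlim (s j))

end ProductWeights

section Kernel

lemma fourierKernel_eq_mul_sinc (R u : ℝ) : fourierKernel R u = R * Real.sinc (R * u) := by
  by_cases hu : u = 0
  · simp [fourierKernel, hu]
  by_cases hR : R = 0
  · simp [fourierKernel, hu, hR]
  rw [fourierKernel, if_neg hu, Real.sinc_of_ne_zero (mul_ne_zero hR hu)]
  field

lemma fourierKernel_neg (R u : ℝ) : fourierKernel R (-u) = fourierKernel R u := by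
  simp only [fourierKernel_eq_mul_sinc, mul_neg, Real.sinc_neg]

lemma continuous_fourierKernel (R : ℝ) : Continuous (fourierKernel R) := by
  simp_rw [funext (fourierKernel_eq_mul_sinc R)]
  exact continuous_const.mul (Real.continuous_sinc.comp (continuous_const.mul continuous_id))

lemma abs_fourierKernel_le (R u : ℝ) : |fourierKernel R u| ≤ |R| := by
  rw [fourierKernel_eq_mul_sinc, abs_mul]
  exact mul_le_of_le_one_right (abs_nonneg R) (Real.abs_sinc_le_one _)

/-- The box weight `½ · 1_{[-R, R]}`, whose Fourier transform is `fourierKernel R`. -/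
noncomputable def boxWeight (R t : ℝ) : ℝ := if |t| ≤ R then 1 / 2 else 0

/-- The tent weight `½ (1 - |t| / 2R)⁺`, a rescaled convolution square of the box weight; its
Fourier transform is `(fourierKernel R) ^ 2 / R`. -/
noncomputable def tentWeight (R t : ℝ) : ℝ := max (1 - |t| / (2 * R)) 0 / 2

lemma integral_even_mul_exp_mul_I {a : ℝ → ℝ} (ha : Integrable fun t => a |t|) (u : ℝ) :
    ∫ t : ℝ, (a |t| : ℂ) * Complex.exp (t * u * Complex.I)
      = (2 * ∫ t in Set.Ioi (0 : ℝ), a t * Real.cos (t * u) : ℝ) := by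
  have hint (w : ℝ) : Integrable fun t : ℝ => (a |t| : ℂ) * Complex.exp (t * w * Complex.I) :=
    ha.ofReal.mul_bdd (c := 1) (by fun_prop) (.of_forall fun t => by
      rw [← Complex.ofReal_mul, Complex.norm_exp_ofReal_mul_I])
  have hneg : ∫ t : ℝ, (a |t| : ℂ) * Complex.exp (t * u * Complex.I)
      = ∫ t : ℝ, (a |t| : ℂ) * Complex.exp (t * (-u : ℝ) * Complex.I) := by
    rw [← integral_neg_eq_self]
    simp
  have hsum (t : ℝ) : (a |t| : ℂ) * Complex.exp (t * u * Complex.I)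
      + (a |t| : ℂ) * Complex.exp (t * (-u : ℝ) * Complex.I)
      = ((2 * (a |t| * Real.cos (|t| * u)) : ℝ) : ℂ) := by
    have : Real.cos (|t| * u) = Real.cos (t * u) := by
      rw [← Real.cos_abs, abs_mul, abs_abs, ← abs_mul, Real.cos_abs]
    rw [this]
    push_cast
    rw [Complex.cos, mul_neg, neg_mul]
    ring_nf
  have htwo : 2 * ∫ t : ℝ, (a |t| : ℂ) * Complex.exp (t * u * Complex.I)
      = 2 * (2 * ∫ t in Set.Ioi (0 : ℝ), a t * Real.cos (t * u) : ℝ) := by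
    rw [two_mul]
    nth_rewrite 2 [hneg]
    rw [← integral_add (hint u) (hint (-u))]
    simp_rw [hsum]
    rw [integral_complex_ofReal, integral_const_mul,
      integral_comp_abs (f := fun t => a t * Real.cos (t * u))]
    push_cast
    rfl
  exact mul_left_cancel₀ two_ne_zero htwo

lemma integrable_boxWeight (R : ℝ) : Integrable (boxWeight R) := by
  have : boxWeight R = (Set.Icc (-R) R).indicator fun _ => 1 / 2 := by
    ext t
    simp [boxWeight, Set.indicator_apply, abs_le]
  rw [this]
  exact (integrable_indicator_iff measurableSet_Icc).2 (integrableOn_const (by simp))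

lemma boxWeight_mem_Icc (R t : ℝ) : boxWeight R t ∈ Set.Icc 0 (1 / 2) := by
  rw [boxWeight]
  split_ifs <;> norm_num

lemma abs_boxWeight_le (R t : ℝ) : |boxWeight R t| ≤ 1 / 2 :=
  abs_le.2 ⟨by linarith [(boxWeight_mem_Icc R t).1], (boxWeight_mem_Icc R t).2⟩

lemma tendsto_boxWeight (t : ℝ) : Tendsto (fun R => boxWeight R t) atTop (𝓝 (1 / 2)) :=
  tendsto_const_nhds.congr' <| by
    filter_upwards [eventually_ge_atTop |t|] with R hR
    rw [boxWeight, if_pos hR]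

lemma integral_boxWeight_mul_exp_mul_I {R : ℝ} (hR : 0 ≤ R) (u : ℝ) :
    ∫ t : ℝ, (boxWeight R t : ℂ) * Complex.exp (t * u * Complex.I) = fourierKernel R u := by
  have hcos : ∫ t in 0..R, Real.cos (t * u) = fourierKernel R u := by
    by_cases hu : u = 0
    · simp [fourierKernel, hu]
    · simp [fourierKernel, hu, intervalIntegral.integral_comp_mul_right, div_eq_inv_mul]
  have hset : ∫ t in Set.Ioi (0 : ℝ), (if t ≤ R then 1 / 2 else 0 : ℝ) * Real.cos (t * u)
      = 1 / 2 * ∫ t in 0..R, Real.cos (t * u) := by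
    rw [intervalIntegral.integral_of_le hR, ← Set.Ioi_inter_Iic,
      ← setIntegral_indicator measurableSet_Iic, ← integral_const_mul]
    simp [Set.indicator_apply]
  rw [← hcos]
  exact (integral_even_mul_exp_mul_I (a := fun t => if t ≤ R then 1 / 2 else 0)
    (integrable_boxWeight R) u).trans (by rw [hset]; simp)

lemma continuous_tentWeight (R : ℝ) : Continuous (tentWeight R) := by
  unfold tentWeight
  fun_prop

lemma tentWeight_eq_zero {R t : ℝ} (hR : 0 < R) (ht : 2 * R ≤ |t|) : tentWeight R t = 0 := by
  have : 1 - |t| / (2 * R) ≤ 0 := sub_nonpos.2 ((one_le_div (by positivity)).2 ht)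
  rw [tentWeight, max_eq_right this, zero_div]

lemma integrable_tentWeight {R : ℝ} (hR : 0 < R) : Integrable (tentWeight R) := by
  refine (continuous_tentWeight R).integrable_of_hasCompactSupport
    (HasCompactSupport.intro (isCompact_Icc (a := -(2 * R)) (b := 2 * R)) fun t ht => ?_)
  rw [Set.mem_Icc, ← abs_le, not_le] at ht
  exact tentWeight_eq_zero hR ht.le

lemma abs_tentWeight_le {R : ℝ} (hR : 0 ≤ R) (t : ℝ) : |tentWeight R t| ≤ 1 / 2 := by
  have : 0 ≤ |t| / (2 * R) := by positivity
  rw [tentWeight, abs_of_nonneg (by positivity)]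
  gcongr
  exact max_le (by linarith) zero_le_one

lemma tendsto_tentWeight (t : ℝ) : Tendsto (fun R => tentWeight R t) atTop (𝓝 (1 / 2)) := by
  have : Tendsto (fun R : ℝ => |t| / (2 * R)) atTop (𝓝 0) :=
    (tendsto_id.const_mul_atTop two_pos).const_div_atTop _
  simpa [tentWeight] using ((this.const_sub 1).max (tendsto_const_nhds (x := (0 : ℝ)))).div_const 2

lemma integral_one_sub_div_mul_cos {R : ℝ} (hR : 0 < R) (u : ℝ) :
    ∫ t in 0..2 * R, (1 - t / (2 * R)) / 2 * Real.cos (t * u)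
      = fourierKernel R u ^ 2 / R / 2 := by
  by_cases hu : u = 0
  · simp [fourierKernel, hu]
    field_simp
    ring
  let F (t : ℝ) : ℝ := (1 - t / (2 * R)) / 2 * (Real.sin (t * u) / u)
    - Real.cos (t * u) / (4 * R * u ^ 2)
  have hF (t : ℝ) : HasDerivAt F ((1 - t / (2 * R)) / 2 * Real.cos (t * u)) t := by
    have hlin : HasDerivAt (fun t => (1 - t / (2 * R)) / 2) (-(1 / (2 * R)) / 2) t :=
      (((hasDerivAt_id t).div_const (2 * R)).const_sub 1).div_const 2
    have hmul : HasDerivAt (fun t => t * u) u t := by simpa using (hasDerivAt_id t).mul_const u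
    refine ((hlin.mul (hmul.sin.div_const u)).sub
      (hmul.cos.div_const (4 * R * u ^ 2))).congr_deriv ?_
    field_simp
    ring
  rw [intervalIntegral.integral_eq_sub_of_hasDerivAt (fun t _ => hF t)
    (by apply Continuous.intervalIntegrable; fun_prop), fourierKernel, if_neg hu]
  have hdouble : Real.cos (2 * R * u) = 1 - 2 * Real.sin (R * u) ^ 2 := by
    rw [mul_assoc, Real.cos_two_mul, Real.cos_sq']
    ring
  simp only [F, hdouble, zero_mul, Real.sin_zero, Real.cos_zero]
  field

lemma integral_tentWeight_mul_exp_mul_I {R : ℝ} (hR : 0 < R) (u : ℝ) :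
    ∫ t : ℝ, (tentWeight R t : ℂ) * Complex.exp (t * u * Complex.I)
      = (fourierKernel R u ^ 2 / R : ℝ) := by
  let a (t : ℝ) : ℝ := max (1 - t / (2 * R)) 0 / 2
  have hset : ∫ t in Set.Ioi (0 : ℝ), a t * Real.cos (t * u)
      = ∫ t in 0..2 * R, (1 - t / (2 * R)) / 2 * Real.cos (t * u) := by
    rw [intervalIntegral.integral_of_le (by positivity), ← Set.Ioi_inter_Iic,
      ← setIntegral_indicator measurableSet_Iic]
    congr 1 with t
    by_cases ht : t ≤ 2 * R
    · have : 0 ≤ 1 - t / (2 * R) := sub_nonneg.2 ((div_le_one (by positivity)).2 ht)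
      simp [a, ht, max_eq_left this]
    · have : 1 - t / (2 * R) ≤ 0 :=
        sub_nonpos.2 ((one_le_div (by positivity)).2 (not_le.1 ht).le)
      simp [a, ht, max_eq_right this]
  refine (integral_even_mul_exp_mul_I (a := a) (integrable_tentWeight hR) u).trans ?_
  rw [hset, integral_one_sub_div_mul_cos hR, mul_div_cancel₀ _ two_ne_zero]

end Kernel

section Slutsky

variable {Ω Ω' : Type*} [MeasurableSpace Ω] [MeasurableSpace Ω'] {P : Measure Ω} {P' : Measure Ω'}
  {κ : Type*} {l : Filter κ}

lemma tendstoInMeasure_const_of_tendsto {a : κ → ℝ} {c : ℝ} (ha : Tendsto a l (𝓝 c)) :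
    TendstoInMeasure P (fun r _ => a r) l fun _ => c := by
  intro ε hε
  have := EMetric.tendsto_nhds.1 ha ε hε
  refine tendsto_const_nhds.congr' (this.mono fun r hr => ?_)
  simp [not_le.2 hr]

lemma tendstoInDistribution_comp_prodMk_of_tendsto [IsProbabilityMeasure P]
    [IsProbabilityMeasure P'] [l.IsCountablyGenerated] {Y : κ → Ω → ℝ} {Z : Ω' → ℝ} {a : κ → ℝ}
    {c : ℝ} {g : ℝ × ℝ → ℝ} (hg : Continuous g)
    (hY : TendstoInDistribution Y l Z (fun _ => P) P') (ha : Tendsto a l (𝓝 c)) :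
    TendstoInDistribution (fun r ω => g (Y r ω, a r)) l (fun ω => g (Z ω, c)) (fun _ => P) P' :=
  hY.continuous_comp_prodMk_of_tendstoInMeasure_const hg
    (tendstoInMeasure_const_of_tendsto ha) fun _ => aemeasurable_const

end Slutsky

section KernelMoments

variable {ι : Type*} [Fintype ι]

/-- The product of one-dimensional Fourier kernels, in terms of which the Fourier density estimator
is a sample mean. -/
noncomputable def fourierProdKernel (R : ℝ) (y : EuclideanSpace ℝ ι) : ℝ :=
  ∏ j, fourierKernel R (y j)

lemma continuous_fourierProdKernel (R : ℝ) :
    Continuous (fourierProdKernel R : EuclideanSpace ℝ ι → ℝ) :=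
  continuous_finsetProd _ fun j _ => (continuous_fourierKernel R).comp (PiLp.continuous_apply 2 _ j)

lemma abs_fourierProdKernel_le (R : ℝ) (y : EuclideanSpace ℝ ι) :
    |fourierProdKernel R y| ≤ |R| ^ Fintype.card ι := by
  rw [fourierProdKernel, Finset.abs_prod, ← Finset.card_univ, ← Finset.prod_const]
  exact Finset.prod_le_prod (fun _ _ => abs_nonneg _) fun _ _ => abs_fourierKernel_le _ _

variable {ν : Measure (EuclideanSpace ℝ ι)}

lemma tendsto_integral_fourierProdKernel [IsFiniteMeasure ν] (hν : Integrable (charFun ν)) {q : ℝ}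
    (hq : ∫ s, charFun ν s = ((2 * π) ^ Fintype.card ι * q : ℝ)) :
    Tendsto (fun R => ∫ y, fourierProdKernel R y ∂ν) atTop (𝓝 (π ^ Fintype.card ι * q)) := by
  have hlim := tendsto_integral_prod_of_charFun_integrable hν
    (.of_forall integrable_boxWeight) (.of_forall abs_boxWeight_le) tendsto_boxWeight
    ((eventually_ge_atTop 0).mono fun R hR => integral_boxWeight_mul_exp_mul_I hR)
  rwa [hq, Complex.ofReal_re, ← mul_assoc, ← mul_pow, one_div,
    inv_mul_cancel_left₀ two_ne_zero] at hlim

lemma tendsto_integral_sq_fourierProdKernel_div_pow [IsFiniteMeasure ν]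
    (hν : Integrable (charFun ν)) {q : ℝ}
    (hq : ∫ s, charFun ν s = ((2 * π) ^ Fintype.card ι * q : ℝ)) :
    Tendsto (fun R => (∫ y, fourierProdKernel R y ^ 2 ∂ν) / R ^ Fintype.card ι) atTop
      (𝓝 (π ^ Fintype.card ι * q)) := by
  have hlim := tendsto_integral_prod_of_charFun_integrable hν
    ((eventually_gt_atTop 0).mono fun R hR => integrable_tentWeight hR)
    ((eventually_ge_atTop 0).mono fun R hR => abs_tentWeight_le hR) tendsto_tentWeight
    ((eventually_gt_atTop 0).mono fun R hR => integral_tentWeight_mul_exp_mul_I hR)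
  simpa only [fourierProdKernel, Finset.prod_div_distrib, Finset.prod_pow, Finset.prod_const,
    Finset.card_univ, integral_div, hq, Complex.ofReal_re, ← mul_assoc, ← mul_pow, one_div,
    inv_mul_cancel_left₀ (two_ne_zero (α := ℝ))] using hlim

lemma tendsto_variance_fourierProdKernel_div_pow [Nonempty ι] [IsProbabilityMeasure ν]
    (hν : Integrable (charFun ν)) {q : ℝ}
    (hq : ∫ s, charFun ν s = ((2 * π) ^ Fintype.card ι * q : ℝ)) :
    Tendsto (fun R => Var[fourierProdKernel R; ν] / R ^ Fintype.card ι) atTop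
      (𝓝 (π ^ Fintype.card ι * q)) := by
  have hmean := ((tendsto_integral_fourierProdKernel hν hq).pow 2).div_atTop
    (tendsto_pow_atTop (α := ℝ) (Fintype.card_ne_zero (α := ι)))
  have hsub := (tendsto_integral_sq_fourierProdKernel_div_pow hν hq).sub hmean
  rw [sub_zero] at hsub
  refine hsub.congr fun R => ?_
  have hmem : MemLp (fourierProdKernel R) 2 ν :=
    .of_bound (continuous_fourierProdKernel R).aestronglyMeasurable _
      (.of_forall (abs_fourierProdKernel_le R))
  rw [variance_eq_sub hmem, sub_div]
  rfl

end KernelMoments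

section EstimatorCLT

variable {d : ℕ} {Ω : Type*} {X : ℕ → Ω → EuclideanSpace ℝ (Fin d)}
  {x : EuclideanSpace ℝ (Fin d)}

lemma fourierEstimator_eq_sum_fourierProdKernel (n : ℕ) (R : ℝ) (ω : Ω) :
    fourierEstimator X n R x ω
      = 1 / (n * π ^ d) * ∑ i ∈ Finset.range n, fourierProdKernel R (X i ω - x) := by
  simp only [fourierEstimator, fourierProdKernel]
  congr! 3 with i _ j
  rw [← fourierKernel_neg]
  simp

lemma sqrt_mul_fourierEstimator_sub_eq (n : ℕ) (R q m : ℝ) (ω : Ω) :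
    √(n / R ^ d) * (fourierEstimator X n R x ω - q)
      = (√n)⁻¹ * (∑ i ∈ Finset.range n, fourierProdKernel R (X i ω - x) / (π ^ d * √(R ^ d))
          - n * (m / (π ^ d * √(R ^ d))))
        + √(n / R ^ d) * (m / π ^ d - q) := by
  rw [fourierEstimator_eq_sum_fourierProdKernel, ← Finset.sum_div, Real.sqrt_div n.cast_nonneg]
  generalize ∑ i ∈ Finset.range n, fourierProdKernel R (X i ω - x) = S
  rcases n.eq_zero_or_pos with rfl | hn
  · simp
  have hsq : (n : ℝ) = √n ^ 2 := (Real.sq_sqrt n.cast_nonneg).symm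
  have hsqrt : √(n : ℝ) ≠ 0 := by positivity
  by_cases hR : √(R ^ d) = 0
  · simp [hR]
  rw [hsq, Real.sqrt_sq (Real.sqrt_nonneg _)]
  field

variable [MeasurableSpace Ω] {P : Measure Ω}
  {ν : Measure (EuclideanSpace ℝ (Fin d))}

lemma variance_fourierProdKernel_sub (hlaw : HasLaw (fun ω => X 0 ω - x) ν P) {R : ℝ} (hR : 0 ≤ R) :
    Var[fun ω => fourierProdKernel R (X 0 ω - x) / (π ^ d * √(R ^ d)); P]
      = Var[fourierProdKernel R; ν] / R ^ d / (π ^ d) ^ 2 := by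
  have hmap : Var[fourierProdKernel R; ν] = Var[fun ω => fourierProdKernel R (X 0 ω - x); P] := by
    rw [← hlaw.map_eq]
    exact variance_map (continuous_fourierProdKernel R).aemeasurable hlaw.aemeasurable
  simp_rw [hmap, div_eq_mul_inv]
  rw [variance_mul_const, inv_pow, mul_pow, Real.sq_sqrt (by positivity), mul_inv, mul_assoc,
    mul_comm (R ^ d)⁻¹]

lemma tendsto_variance_fourierProdKernel_sub_div [IsProbabilityMeasure P] (hd : 0 < d)
    (hlaw : HasLaw (fun ω => X 0 ω - x) ν P) (hν : Integrable (charFun ν)) {q : ℝ}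
    (hq : ∫ s, charFun ν s = ((2 * π) ^ d * q : ℝ)) {R : ℕ → ℝ} (hR : Tendsto R atTop atTop) :
    Tendsto (fun n => Var[fun ω => fourierProdKernel (R n) (X 0 ω - x) / (π ^ d * √(R n ^ d)); P])
      atTop (𝓝 (q / π ^ d).toNNReal) := by
  have : NeZero d := ⟨hd.ne'⟩
  have : IsProbabilityMeasure ν := hlaw.isProbabilityMeasure_iff.1 inferInstance
  have hlim := ((tendsto_variance_fourierProdKernel_div_pow hν
    (by simpa using hq)).comp hR).div_const ((π ^ d) ^ 2)
  have heq : π ^ d * q / (π ^ d) ^ 2 = q / π ^ d := by field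
  simp only [Fintype.card_fin, heq] at hlim
  replace hlim := hlim.congr' ((hR.eventually_ge_atTop 0).mono fun n hn =>
    (variance_fourierProdKernel_sub hlaw hn).symm)
  rwa [Real.coe_toNNReal _ (ge_of_tendsto' hlim fun n => variance_nonneg _ _)]

lemma tendsto_pow_div_sqrt_pow_div_sqrt {R : ℕ → ℝ} (hR : ∀ᶠ n in atTop, 0 ≤ R n)
    (hRn : Tendsto (fun n : ℕ => R n ^ d / n) atTop (𝓝 0)) :
    Tendsto (fun n : ℕ => |R n| ^ d / (π ^ d * √(R n ^ d)) / √n) atTop (𝓝 0) := by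
  have := hRn.sqrt.div_const (π ^ d)
  rw [Real.sqrt_zero, zero_div] at this
  refine this.congr' (hR.mono fun n hn => ?_)
  beta_reduce
  rw [abs_of_nonneg hn, div_mul_eq_div_div_swap, Real.div_sqrt, Real.sqrt_div (by positivity)]
  ring

lemma tendstoInDistribution_fourierEstimator_of_bias [IsProbabilityMeasure P] (hd : 0 < d)
    (hlaw : ∀ i, HasLaw (fun ω => X i ω - x) ν P) (hindep : iIndepFun X P)
    (hν : Integrable (charFun ν)) {q : ℝ} (hq : ∫ s, charFun ν s = ((2 * π) ^ d * q : ℝ))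
    {R : ℕ → ℝ} (hR : Tendsto R atTop atTop)
    (hRn : Tendsto (fun n : ℕ => R n ^ d / n) atTop (𝓝 0))
    (hbias : Tendsto (fun n : ℕ =>
      √(n / R n ^ d) * ((∫ y, fourierProdKernel (R n) y ∂ν) / π ^ d - q)) atTop (𝓝 0)) :
    TendstoInDistribution (fun (n : ℕ) ω => √(n / R n ^ d) * (fourierEstimator X n (R n) x ω - q))
      atTop (id : ℝ → ℝ) (fun _ => P) (gaussianReal 0 (q / π ^ d).toNNReal) := by
  let k (n : ℕ) (y : EuclideanSpace ℝ (Fin d)) := fourierProdKernel (R n) y / (π ^ d * √(R n ^ d))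
  have hk n : Measurable (k n) := ((continuous_fourierProdKernel (R n)).div_const _).measurable
  have hbound (n : ℕ) (y) : |k n y| ≤ |R n| ^ d / (π ^ d * √(R n ^ d)) := by
    rw [abs_div, abs_of_nonneg (by positivity : 0 ≤ π ^ d * √(R n ^ d))]
    gcongr
    simpa using abs_fourierProdKernel_le (R n) y
  have hmean (n : ℕ) : P[fun ω => k n (X 0 ω - x)]
      = (∫ y, fourierProdKernel (R n) y ∂ν) / (π ^ d * √(R n ^ d)) :=
    ((hlaw 0).integral_comp (hk n).aestronglyMeasurable).trans (integral_div _ _)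
  have hclt := tendstoInDistribution_inv_sqrt_mul_sum_array (P := P)
    (Y := fun n i ω => k n (X i ω - x)) (HasLaw.id (μ := gaussianReal 0 (q / π ^ d).toNNReal))
    (fun n => hindep.comp (fun _ y => k n (y - x)) fun _ => (hk n).comp (by fun_prop))
    (fun n i => ((hlaw i).identDistrib (hlaw 0)).comp (hk n))
    (fun n => .of_forall fun _ => hbound n _)
    (tendsto_pow_div_sqrt_pow_div_sqrt (hR.eventually_ge_atTop 0) hRn)
    (tendsto_variance_fourierProdKernel_sub_div hd (hlaw 0) hν hq hR)
  refine (tendstoInDistribution_comp_prodMk_of_tendsto continuous_add hclt hbias).congr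
    (fun n => .of_forall fun ω => ?_) (.of_forall add_zero)
  simp only [hmean]
  exact (sqrt_mul_fourierEstimator_sub_eq n (R n) q _ ω).symm

end EstimatorCLT

section SupersmoothTail

variable {α b : ℝ}

lemma integrableOn_Ioi_exp_neg_mul_rpow (hα : 0 < α) (hb : 0 < b) :
    IntegrableOn (fun u : ℝ => Real.exp (-b * u ^ α)) (Set.Ioi 0) := by
  simpa using integrableOn_rpow_mul_exp_neg_mul_rpow (s := 0) (by norm_num) hα hb

lemma integrable_exp_neg_mul_abs_rpow (hα : 0 < α) (hb : 0 < b) :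
    Integrable fun u : ℝ => Real.exp (-b * |u| ^ α) := by
  have : NeZero (volume.restrict (Set.Ioi (0 : ℝ))) := ⟨by simp⟩
  refine .of_integral_ne_zero ?_
  rw [integral_comp_abs (f := fun u => Real.exp (-b * u ^ α))]
  exact mul_ne_zero two_ne_zero (integral_exp_pos (integrableOn_Ioi_exp_neg_mul_rpow hα hb)).ne'

lemma hasDerivAt_rpow_mul_exp_neg_mul_rpow {u : ℝ} (hu : 0 < u) :
    HasDerivAt (fun u => -(u ^ (1 - α) * Real.exp (-b * u ^ α)))
      ((b * α - (1 - α) * u ^ (-α)) * Real.exp (-b * u ^ α)) u := by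
  have hpow (β : ℝ) : HasDerivAt (fun u : ℝ => u ^ β) (β * u ^ (β - 1)) u :=
    Real.hasDerivAt_rpow_const (.inl hu.ne')
  refine ((hpow (1 - α)).mul ((hpow α).const_mul (-b)).exp).neg.congr_deriv ?_
  have hone : u ^ (1 - α) * u ^ (α - 1) = 1 := by
    rw [← Real.rpow_add hu]
    simp
  rw [show 1 - α - 1 = -α by ring]
  linear_combination b * α * Real.exp (-b * u ^ α) * hone

lemma tendsto_rpow_mul_exp_neg_mul_rpow (hα : 0 < α) (hb : 0 < b) (s : ℝ) :
    Tendsto (fun R : ℝ => R ^ s * Real.exp (-b * R ^ α)) atTop (𝓝 0) := by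
  refine ((tendsto_rpow_mul_exp_neg_mul_atTop_nhds_zero (s / α) b hb).comp
    (tendsto_rpow_atTop hα)).congr' ?_
  filter_upwards [eventually_ge_atTop 0] with R hR
  simp only [Function.comp_apply]
  rw [← Real.rpow_mul hR, mul_div_cancel₀ _ hα.ne']

lemma eventually_integral_Ioi_exp_neg_mul_rpow_le (hα : 0 < α) (hb : 0 < b) :
    ∀ᶠ R in atTop, ∫ u in Set.Ioi R, Real.exp (-b * u ^ α)
      ≤ 2 / (b * α) * (R ^ (1 - α) * Real.exp (-b * R ^ α)) := by
  have hdom : ∀ᶠ u in atTop, b * α / 2 ≤ b * α - (1 - α) * u ^ (-α) := by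
    have := ((tendsto_rpow_neg_atTop hα).const_mul (1 - α)).const_sub (b * α)
    rw [mul_zero, sub_zero] at this
    exact this.eventually_const_le (half_lt_self (by positivity))
  filter_upwards [eventually_forall_ge_atTop.2 hdom, eventually_gt_atTop 0] with R hR hR0
  let G (u : ℝ) : ℝ := (b * α - (1 - α) * u ^ (-α)) * Real.exp (-b * u ^ α)
  have hGderiv (u : ℝ) (hu : u ∈ Set.Ici R) := hasDerivAt_rpow_mul_exp_neg_mul_rpow (α := α)
    (b := b) (hR0.trans_le hu)
  have hGnonneg (u : ℝ) (hu : u ∈ Set.Ioi R) : 0 ≤ G u :=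
    mul_nonneg (le_trans (by positivity) (hR u (le_of_lt hu))) (Real.exp_pos _).le
  have hlim : Tendsto (fun u : ℝ => -(u ^ (1 - α) * Real.exp (-b * u ^ α))) atTop (𝓝 0) := by
    simpa using (tendsto_rpow_mul_exp_neg_mul_rpow hα hb (1 - α)).neg
  have hGint := integrableOn_Ioi_deriv_of_nonneg' hGderiv hGnonneg hlim
  have hint := (integrableOn_Ioi_exp_neg_mul_rpow hα hb).mono_set (Set.Ioi_subset_Ioi hR0.le)
  calc ∫ u in Set.Ioi R, Real.exp (-b * u ^ α)
      ≤ ∫ u in Set.Ioi R, 2 / (b * α) * G u :=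
        setIntegral_mono_on hint (hGint.const_mul _) measurableSet_Ioi fun u hu => by
          rw [← mul_assoc]
          refine le_mul_of_one_le_left (Real.exp_pos _).le ?_
          rw [div_mul_eq_mul_div, one_le_div (by positivity)]
          linarith [hR u (le_of_lt hu)]
    _ = _ := by
        rw [integral_const_mul, integral_Ioi_of_hasDerivAt_of_tendsto' hGderiv hGint hlim]
        ring

lemma tendsto_exp_mul_integral_Ioi_exp_neg_mul_rpow {c β : ℝ} (hα : 0 < α) (hb : 0 < b)
    (h : c < b ∨ (c = b ∧ 1 - α < β)) :
    Tendsto (fun R : ℝ => Real.exp (c * R ^ α) / R ^ β * ∫ u in Set.Ioi R, Real.exp (-b * u ^ α))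
      atTop (𝓝 0) := by
  have hlim : Tendsto (fun R : ℝ => R ^ (1 - α - β) * Real.exp (-(b - c) * R ^ α)) atTop (𝓝 0) := by
    rcases h with h | ⟨rfl, h⟩
    · exact tendsto_rpow_mul_exp_neg_mul_rpow hα (sub_pos.2 h) _
    · simpa using tendsto_rpow_neg_atTop (sub_pos.2 h)
  have hbound := hlim.const_mul (2 / (b * α))
  rw [mul_zero] at hbound
  refine squeeze_zero' ?_ ?_ hbound
  · filter_upwards [eventually_ge_atTop 0] with R hR
    have := setIntegral_nonneg (μ := volume) (measurableSet_Ioi (a := R))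
      fun u _ => (Real.exp_pos (-b * u ^ α)).le
    positivity
  · filter_upwards [eventually_integral_Ioi_exp_neg_mul_rpow_le hα hb, eventually_gt_atTop 0]
      with R htail hR
    calc _ ≤ Real.exp (c * R ^ α) / R ^ β *
          (2 / (b * α) * (R ^ (1 - α) * Real.exp (-b * R ^ α))) := by gcongr
      _ = _ := by
        rw [Real.rpow_sub hR (1 - α), show -(b - c) * R ^ α = c * R ^ α + -b * R ^ α by ring,
          Real.exp_add]
        ring

end SupersmoothTail

section Bias

variable {ι : Type*} [Fintype ι]

lemma prod_boxWeight_le_half_pow (R : ℝ) (s : EuclideanSpace ℝ ι) :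
    ∏ j, boxWeight R (s j) ≤ (1 / 2) ^ Fintype.card ι := by
  rw [← Finset.card_univ, ← Finset.prod_const]
  exact Finset.prod_le_prod (fun j _ => (boxWeight_mem_Icc R (s j)).1)
    fun j _ => (boxWeight_mem_Icc R (s j)).2

lemma norm_prod_boxWeight_sub_half_pow (R : ℝ) (s : EuclideanSpace ℝ ι) :
    ‖(∏ j, (boxWeight R (s j) : ℂ)) - (1 / 2) ^ Fintype.card ι‖
      = (1 / 2) ^ Fintype.card ι - ∏ j, boxWeight R (s j) := by
  rw [norm_sub_rev, ← abs_of_nonneg (sub_nonneg.2 (prod_boxWeight_le_half_pow R s)),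
    ← Real.norm_eq_abs, ← Complex.norm_real]
  simp

variable {ν : Measure (EuclideanSpace ℝ ι)} [IsFiniteMeasure ν] {g : ℝ → ℝ} {K q R : ℝ}

lemma integral_prod_boxWeight_mul_charFun (hR : 0 ≤ R) :
    ∫ s : EuclideanSpace ℝ ι, (∏ j, (boxWeight R (s j) : ℂ)) * charFun ν s
      = (∫ y, fourierProdKernel R y ∂ν : ℝ) := by
  have hbox : Integrable fun t => (boxWeight R t : ℂ) := (integrable_boxWeight R).ofReal
  rw [integral_prod_mul_charFun hbox, ← integral_complex_ofReal]
  simp [fourierProdKernel, integral_boxWeight_mul_exp_mul_I hR]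

lemma integrable_charFun_of_norm_le_prod (hg : Integrable g)
    (hφ : ∀ s, ‖charFun ν s‖ ≤ K * ∏ j, g (s j)) : Integrable (charFun ν) :=
  ((integrable_euclideanSpace_prod fun _ => hg).const_mul K).mono'
    measurable_charFun.aestronglyMeasurable (.of_forall hφ)

lemma abs_integral_fourierProdKernel_sub_le_sub (hg : Integrable g)
    (hφ : ∀ s, ‖charFun ν s‖ ≤ K * ∏ j, g (s j))
    (hq : ∫ s, charFun ν s = ((2 * π) ^ Fintype.card ι * q : ℝ)) (hR : 0 ≤ R) :
    |(∫ y, fourierProdKernel R y ∂ν) - π ^ Fintype.card ι * q|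
      ≤ K * ((∫ u, 1 / 2 * g u) ^ Fintype.card ι
        - (∫ u, boxWeight R u * g u) ^ Fintype.card ι) := by
  have hcharFun := integrable_charFun_of_norm_le_prod hg hφ
  have hbox : Integrable fun t => (boxWeight R t : ℂ) := (integrable_boxWeight R).ofReal
  have hhalf : ∫ s, (1 / 2 : ℂ) ^ Fintype.card ι * charFun ν s
      = (π ^ Fintype.card ι * q : ℝ) := by
    rw [integral_const_mul, hq]
    push_cast
    rw [← mul_assoc, ← mul_pow]
    ring_nf
  have hint_box : Integrable fun s : EuclideanSpace ℝ ι =>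
      (∏ j, (boxWeight R (s j) : ℂ)) * charFun ν s :=
    (integrable_euclideanSpace_prod fun _ => hbox).mul_bdd measurable_charFun.aestronglyMeasurable
      (.of_forall norm_charFun_le)
  have hint_half_prod := integrable_euclideanSpace_prod (ι := ι) fun _ => hg.const_mul (1 / 2)
  have hint_box_prod := integrable_euclideanSpace_prod (ι := ι) fun _ =>
    hg.bdd_mul (integrable_boxWeight R).aestronglyMeasurable (.of_forall (abs_boxWeight_le R))
  rw [← Real.norm_eq_abs, ← Complex.norm_real, Complex.ofReal_sub,
    ← integral_prod_boxWeight_mul_charFun hR, ← hhalf,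
    ← integral_sub hint_box (hcharFun.const_mul _)]
  calc ‖∫ s : EuclideanSpace ℝ ι, ((∏ j, (boxWeight R (s j) : ℂ)) * charFun ν s
        - (1 / 2) ^ Fintype.card ι * charFun ν s)‖
      ≤ ∫ s : EuclideanSpace ℝ ι,
          K * (∏ j, 1 / 2 * g (s j) - ∏ j, boxWeight R (s j) * g (s j)) := by
        refine norm_integral_le_of_norm_le ((hint_half_prod.sub hint_box_prod).const_mul K)
          (.of_forall fun s => ?_)
        rw [← sub_mul, norm_mul, norm_prod_boxWeight_sub_half_pow, Finset.prod_mul_distrib,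
          Finset.prod_mul_distrib, Finset.prod_const, Finset.card_univ, ← sub_mul, mul_left_comm]
        exact mul_le_mul_of_nonneg_left (hφ s) (sub_nonneg.2 (prod_boxWeight_le_half_pow R s))
    _ = _ := by
        rw [integral_const_mul, integral_sub hint_half_prod hint_box_prod,
          integral_euclideanSpace_prod fun _ u => 1 / 2 * g u,
          integral_euclideanSpace_prod fun _ u => boxWeight R u * g u]
        simp

lemma integral_half_sub_integral_boxWeight (hg : Integrable fun u => g |u|) (hR : 0 ≤ R) :
    (∫ u, 1 / 2 * g |u|) - ∫ u, boxWeight R u * g |u| = ∫ u in Set.Ioi R, g u := by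
  rw [← integral_sub (hg.const_mul _) (hg.bdd_mul (integrable_boxWeight R).aestronglyMeasurable
    (.of_forall (abs_boxWeight_le R)))]
  have htail (u : ℝ) : 1 / 2 * g |u| - boxWeight R u * g |u|
      = (Set.Ioi R).indicator (fun u => 1 / 2 * g u) |u| := by
    by_cases hu : |u| ≤ R <;> simp [boxWeight, hu, not_le.1]
  simp_rw [htail]
  rw [integral_comp_abs, setIntegral_indicator measurableSet_Ioi, Set.Ioi_inter_Ioi,
    sup_eq_right.2 hR, integral_const_mul]
  ring

lemma abs_integral_fourierProdKernel_sub_le (hg : Integrable fun u => g |u|) (hg0 : ∀ u, 0 < g u)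
    (hφ : ∀ s, ‖charFun ν s‖ ≤ K * ∏ j, g |s j|)
    (hq : ∫ s, charFun ν s = ((2 * π) ^ Fintype.card ι * q : ℝ)) (hR : 0 ≤ R) :
    |(∫ y, fourierProdKernel R y ∂ν) - π ^ Fintype.card ι * q|
      ≤ K * (Fintype.card ι * (∫ u, 1 / 2 * g |u|) ^ (Fintype.card ι - 1))
        * ∫ u in Set.Ioi R, g u := by
  have hK : 0 ≤ K := nonneg_of_mul_nonneg_left ((norm_nonneg _).trans (hφ 0))
    (Finset.prod_pos fun _ _ => hg0 _)
  have hbox0 : 0 ≤ ∫ u, boxWeight R u * g |u| :=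
    integral_nonneg fun u => mul_nonneg (boxWeight_mem_Icc R u).1 (hg0 _).le
  have htail := integral_half_sub_integral_boxWeight hg hR
  have htail0 : 0 ≤ ∫ u in Set.Ioi R, g u := integral_nonneg fun u => (hg0 u).le
  refine (abs_integral_fourierProdKernel_sub_le_sub hg hφ hq hR).trans ?_
  rw [mul_assoc]
  refine mul_le_mul_of_nonneg_left ?_ hK
  have hpow := (le_abs_self _).trans (abs_pow_sub_pow_le (∫ u, 1 / 2 * g |u|)
    (∫ u, boxWeight R u * g |u|) (Fintype.card ι))
  rwa [htail, abs_of_nonneg htail0, abs_of_nonneg hbox0, abs_of_nonneg (by linarith),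
    max_eq_left (by linarith), mul_assoc, mul_comm] at hpow

end Bias

section Radius

variable {d n : ℕ} {α C : ℝ}

lemma tendsto_radius (hα : 0 < α) (hC : 0 < C) {R : ℕ → ℝ}
    (hR : ∀ᶠ n : ℕ in atTop, 0 < R n ∧ R n ^ α = C * Real.log n) : Tendsto R atTop atTop := by
  have hlog : Tendsto (fun n : ℕ => C * Real.log n) atTop atTop :=
    (Real.tendsto_log_atTop.comp tendsto_natCast_atTop_atTop).const_mul_atTop hC
  refine ((tendsto_rpow_atTop (inv_pos.2 hα)).comp hlog).congr' ?_
  filter_upwards [hR] with n ⟨hpos, hpow⟩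
  rw [Function.comp_apply, ← hpow, Real.rpow_rpow_inv hpos.le hα.ne']

lemma natCast_eq_exp_of_rpow_eq_mul_log {R : ℝ} (hC : C ≠ 0) (hn : n ≠ 0)
    (h : R ^ α = C * Real.log n) : (n : ℝ) = Real.exp (1 / C * R ^ α) := by
  rw [h, one_div, inv_mul_cancel_left₀ hC, Real.exp_log (by positivity)]

lemma sqrt_natCast_div_pow_eq {R : ℝ} (hC : C ≠ 0) (hn : n ≠ 0) (hR : 0 ≤ R)
    (h : R ^ α = C * Real.log n) :
    √(n / R ^ d) = Real.exp (1 / (2 * C) * R ^ α) / R ^ ((d : ℝ) / 2) := by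
  rw [Real.sqrt_div n.cast_nonneg, natCast_eq_exp_of_rpow_eq_mul_log hC hn h, ← Real.exp_half,
    Real.sqrt_eq_rpow, ← Real.rpow_natCast, ← Real.rpow_mul hR]
  ring_nf

lemma tendsto_radius_pow_div_natCast (hα : 0 < α) (hC : 0 < C) {R : ℕ → ℝ}
    (hR : ∀ᶠ n : ℕ in atTop, 0 < R n ∧ R n ^ α = C * Real.log n) :
    Tendsto (fun n : ℕ => R n ^ d / n) atTop (𝓝 0) := by
  refine ((tendsto_rpow_mul_exp_neg_mul_rpow hα (one_div_pos.2 hC) d).comp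
    (tendsto_radius hα hC hR)).congr' ?_
  filter_upwards [hR, eventually_ne_atTop 0] with n ⟨_, hpow⟩ hn
  rw [natCast_eq_exp_of_rpow_eq_mul_log hC.ne' hn hpow, Function.comp_apply, Real.rpow_natCast,
    neg_mul, Real.exp_neg, ← div_eq_mul_inv]

lemma tendsto_sqrt_natCast_div_pow_mul_bias {ν : Measure (EuclideanSpace ℝ (Fin d))}
    [IsFiniteMeasure ν] {K C₁ q : ℝ} (hα : 0 < α) (hC₁ : 0 < C₁)
    (hφ : ∀ s, ‖charFun ν s‖ ≤ K * ∏ j, Real.exp (-C₁ * |s j| ^ α))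
    (hq : ∫ s, charFun ν s = ((2 * π) ^ d * q : ℝ))
    (hC : 1 / (2 * C₁) < C ∨ (C = 1 / (2 * C₁) ∧ 1 - α < (d : ℝ) / 2)) {R : ℕ → ℝ}
    (hR : ∀ᶠ n : ℕ in atTop, 0 < R n ∧ R n ^ α = C * Real.log n) :
    Tendsto (fun n : ℕ => √(n / R n ^ d) * ((∫ y, fourierProdKernel (R n) y ∂ν) / π ^ d - q))
      atTop (𝓝 0) := by
  have hC0 : 0 < C := by
    have : 0 < 1 / (2 * C₁) := by positivity
    rcases hC with h | h <;> linarith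
  have hc : 1 / (2 * C) < C₁ ∨ (1 / (2 * C) = C₁ ∧ 1 - α < (d : ℝ) / 2) := by
    refine hC.imp (fun h => ?_) (And.imp_left fun h => ?_)
    · rw [div_lt_iff₀ (by positivity)] at h ⊢
      linarith
    · rw [h]
      field
  obtain ⟨M, hM⟩ : ∃ M, ∀ r, 0 ≤ r → |(∫ y, fourierProdKernel r y ∂ν) - π ^ d * q|
      ≤ M * ∫ u in Set.Ioi r, Real.exp (-C₁ * u ^ α) :=
    ⟨_, fun r hr => by
      simpa only [Fintype.card_fin] using abs_integral_fourierProdKernel_sub_le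
        (g := fun u => Real.exp (-C₁ * u ^ α)) (integrable_exp_neg_mul_abs_rpow hα hC₁)
        (fun _ => Real.exp_pos _) hφ
        (by simpa only [Fintype.card_fin] using hq) hr⟩
  have hlim := (((tendsto_exp_mul_integral_Ioi_exp_neg_mul_rpow hα hC₁ hc).comp
    (tendsto_radius hα hC0 hR)).const_mul M).div_const (π ^ d)
  simp only [mul_zero, zero_div, Function.comp_apply] at hlim
  refine squeeze_zero_norm' ?_ hlim
  filter_upwards [hR, eventually_ne_atTop 0] with n ⟨hpos, hpow⟩ hn
  have hdiv : (∫ y, fourierProdKernel (R n) y ∂ν) / π ^ d - q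
      = ((∫ y, fourierProdKernel (R n) y ∂ν) - π ^ d * q) / π ^ d := by field
  rw [norm_mul, hdiv, Real.norm_of_nonneg (Real.sqrt_nonneg _), Real.norm_eq_abs, abs_div,
    abs_of_pos (by positivity : 0 < π ^ d),
    ← sqrt_natCast_div_pow_eq (d := d) hC0.ne' hn hpos.le hpow, ← mul_div_assoc, mul_left_comm]
  gcongr
  exact hM _ hpos.le

end Radius

section Inversion

variable {E : Type*} [NormedAddCommGroup E] [InnerProductSpace ℝ E] [MeasurableSpace E]
  [BorelSpace E]

lemma norm_charFun_map_add_const (μ : Measure E) (r t : E) :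
    ‖charFun (μ.map (· + r)) t‖ = ‖charFun μ t‖ := by
  rw [charFun_map_add_const, norm_mul, Complex.norm_exp_ofReal_mul_I, mul_one]

variable [FiniteDimensional ℝ E] {p : E → ℝ}

lemma charFun_withDensity_ofReal (hpm : Measurable p) (hp0 : ∀ y, 0 ≤ p y) (t : E) :
    charFun (volume.withDensity fun y => .ofReal (p y)) t
      = ∫ y, Complex.exp (⟪y, t⟫_ℝ * Complex.I) * p y := by
  rw [charFun_apply, integral_withDensity_eq_integral_toReal_smul (by fun_prop)
    (.of_forall fun _ => ENNReal.ofReal_lt_top)]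
  congr 1 with y
  rw [ENNReal.toReal_ofReal (hp0 y), Complex.real_smul, mul_comm]

lemma charFun_withDensity_ofReal_eq_fourier (hpm : Measurable p) (hp0 : ∀ y, 0 ≤ p y) (s : E) :
    charFun (volume.withDensity fun y => .ofReal (p y)) (-(2 * π) • s)
      = FourierTransform.fourier (fun y => (p y : ℂ)) s := by
  rw [charFun_withDensity_ofReal hpm hp0, Real.fourier_eq']
  congr 1 with y
  rw [inner_smul_right, smul_eq_mul, neg_mul 2 π]

lemma integral_charFun_map_neg_of_continuousAt (hp : Integrable p) (hpm : Measurable p)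
    (hp0 : ∀ y, 0 ≤ p y)
    (hφ : Integrable (charFun (volume.withDensity fun y => .ofReal (p y)))) {x : E}
    (hx : ContinuousAt p x) :
    ∫ s, charFun ((volume.withDensity fun y => .ofReal (p y)).map (· + -x)) s
      = ((2 * π) ^ Module.finrank ℝ E * p x : ℝ) := by
  set μ := volume.withDensity fun y => .ofReal (p y)
  have hfourier : FourierTransform.fourier (fun y => (p y : ℂ))
      = fun s => charFun μ (-(2 * π) • s) :=
    funext fun s => (charFun_withDensity_ofReal_eq_fourier hpm hp0 s).symm
  have hint : Integrable (FourierTransform.fourier fun y => (p y : ℂ)) :=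
    hfourier ▸ hφ.comp_smul (neg_ne_zero.2 Real.two_pi_pos.ne')
  have hpC : Integrable fun y => (p y : ℂ) := hp.ofReal
  have hinv := hpC.fourierInv_fourier_eq hint
    (Complex.continuous_ofReal.continuousAt.comp hx)
  have hshift (s : E) : Complex.exp (↑(2 * π * ⟪s, x⟫_ℝ) * Complex.I) • charFun μ (-(2 * π) • s)
      = charFun (μ.map (· + -x)) (-(2 * π) • s) := by
    rw [charFun_map_add_const, smul_eq_mul, mul_comm, inner_smul_right, inner_neg_left,
      real_inner_comm, neg_mul_neg]
  rw [Real.fourierInv_eq', hfourier] at hinv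
  simp only [hshift] at hinv
  rw [Measure.integral_comp_smul, abs_inv, abs_pow, abs_neg, abs_of_pos Real.two_pi_pos,
    inv_smul_eq_iff₀ (by positivity)] at hinv
  rw [hinv, Complex.real_smul, Complex.ofReal_mul]

lemma continuous_integral_charFun_map_neg {μ : Measure E} [IsFiniteMeasure μ]
    (hφ : Integrable (charFun μ)) : Continuous fun x => ∫ s, charFun (μ.map (· + -x)) s := by
  refine continuous_of_dominated (fun x => measurable_charFun.aestronglyMeasurable)
    (fun x => .of_forall fun s => (norm_charFun_map_add_const μ _ s).le) hφ.norm
    (.of_forall fun s => ?_)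
  simp only [charFun_map_add_const]
  fun_prop

lemma integral_charFun_map_neg_of_continuousOn (hp : Integrable p) (hpm : Measurable p)
    (hp0 : ∀ y, 0 ≤ p y)
    (hφ : Integrable (charFun (volume.withDensity fun y => .ofReal (p y)))) {𝒳 : Set E}
    (h𝒳 : 𝒳 ⊆ closure (interior 𝒳)) (hc : ContinuousOn p 𝒳) {x : E} (hx : x ∈ 𝒳) :
    ∫ s, charFun ((volume.withDensity fun y => .ofReal (p y)).map (· + -x)) s
      = ((2 * π) ^ Module.finrank ℝ E * p x : ℝ) := by
  have : (𝓝[interior 𝒳] x).NeBot := mem_closure_iff_nhdsWithin_neBot.1 (h𝒳 hx)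
  have : IsFiniteMeasure (volume.withDensity fun y => .ofReal (p y)) :=
    isFiniteMeasure_withDensity_ofReal hp.2
  have hlim : Tendsto p (𝓝[interior 𝒳] x) (𝓝 (p x)) := (hc x hx).mono interior_subset
  refine tendsto_nhds_unique
    (((continuous_integral_charFun_map_neg hφ).tendsto x).mono_left nhdsWithin_le_nhds)
    (((Complex.continuous_ofReal.tendsto _).comp (hlim.const_mul _)).congr' ?_)
  filter_upwards [self_mem_nhdsWithin] with y hy
  exact (integral_charFun_map_neg_of_continuousAt hp hpm hp0 hφ
    (hc.continuousAt (mem_interior_iff_mem_nhds.1 hy))).symm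

end Inversion

section Density

variable {d : ℕ} {p : EuclideanSpace ℝ (Fin d) → ℝ}

lemma IsProbDensity.charFun_withDensity (hp : IsProbDensity p) :
    charFun (volume.withDensity fun y => .ofReal (p y)) = densityFourier p := by
  ext s
  rw [charFun_withDensity_ofReal hp.measurable hp.nonneg, densityFourier]
  congr 1 with y
  rw [mul_comm Complex.I]
  simp [PiLp.inner_apply]

lemma UpperSupersmoothWith.norm_densityFourier_le_prod {α K C₁ : ℝ}
    (h : UpperSupersmoothWith p α K C₁) (s : EuclideanSpace ℝ (Fin d)) :
    ‖densityFourier p s‖ ≤ K * ∏ j, Real.exp (-C₁ * |s j| ^ α) := by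
  rw [← Real.exp_sum, ← Finset.mul_sum]
  exact h.2 s

end Density

section Coverage

lemma measureReal_Iio_neg_eq_one_sub_cdf {μ : Measure ℝ} [IsProbabilityMeasure μ]
    (hμ : μ.map (fun t => -t) = μ) (z : ℝ) : μ.real (Set.Iio (-z)) = 1 - cdf μ z := by
  rw [cdf_eq_real, ← probReal_compl_eq_one_sub measurableSet_Iic, Set.compl_Iic]
  conv_lhs => rw [← hμ]
  rw [map_measureReal_apply measurable_neg measurableSet_Iio]
  simp

lemma nonneg_of_one_half_lt_cdf {μ : Measure ℝ} [IsProbabilityMeasure μ]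
    (hμ : μ.map (fun t => -t) = μ) {z : ℝ} (hz : 1 / 2 < cdf μ z) : 0 ≤ z := by
  by_contra! hneg
  have hle : μ.real (Set.Iic z) ≤ μ.real (Set.Iio (-z)) :=
    measureReal_mono (Set.Iic_subset_Iio.2 (by linarith))
  rw [measureReal_Iio_neg_eq_one_sub_cdf hμ, ← cdf_eq_real] at hle
  linarith

lemma measureReal_Icc_neg_self {μ : Measure ℝ} [IsProbabilityMeasure μ]
    (hμ : μ.map (fun t => -t) = μ) {z : ℝ} (hz : 0 ≤ z) :
    μ.real (Set.Icc (-z) z) = 2 * cdf μ z - 1 := by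
  have hdiff : Set.Icc (-z) z = Set.Iic z \ Set.Iio (-z) := by
    ext t
    simp [and_comm]
  rw [hdiff, measureReal_sdiff (Set.Iio_subset_Iic (by linarith)) measurableSet_Iio,
    measureReal_Iio_neg_eq_one_sub_cdf hμ, ← cdf_eq_real]
  ring

lemma gaussianReal_zero_map_neg (v : ℝ≥0) :
    (gaussianReal 0 v).map (fun t => -t) = gaussianReal 0 v := by
  rw [gaussianReal_map_neg, neg_zero]

lemma gaussianReal_real_abs_le_mul_sqrt {z v : ℝ} (hv : 0 < v) (hz : 0 ≤ z) :
    (gaussianReal 0 v.toNNReal).real {t | |t| ≤ z * √v} = 2 * cdf (gaussianReal 0 1) z - 1 := by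
  have hmap : (gaussianReal 0 1).map (√v * ·) = gaussianReal 0 v.toNNReal := by
    rw [gaussianReal_map_const_mul, mul_zero, mul_one]
    congr 1
    ext
    simp [Real.sq_sqrt hv.le, hv.le]
  rw [← hmap, map_measureReal_apply (by fun_prop) (measurableSet_le (by fun_prop) (by fun_prop)),
    ← measureReal_Icc_neg_self (gaussianReal_zero_map_neg 1) hz]
  congr 1
  ext t
  rw [Set.mem_preimage, Set.mem_ofPred_eq, Set.mem_Icc, abs_mul, abs_of_pos (Real.sqrt_pos.2 hv),
    mul_comm z, mul_le_mul_iff_right₀ (Real.sqrt_pos.2 hv), abs_le]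

variable {Ω : Type*} [MeasurableSpace Ω] {P : Measure Ω} [IsProbabilityMeasure P]

lemma tendsto_measureReal_preimage_of_null_frontier {Ω' κ E : Type*} [MeasurableSpace Ω']
    {P' : Measure Ω'} [IsProbabilityMeasure P'] [TopologicalSpace E] [MeasurableSpace E]
    [OpensMeasurableSpace E] [HasOuterApproxClosed E] {l : Filter κ} {Y : κ → Ω → E} {Z : Ω' → E}
    {s : Set E} (hY : TendstoInDistribution Y l Z (fun _ => P) P') (hs : MeasurableSet s)
    (hfrontier : P' (Z ⁻¹' frontier s) = 0) :
    Tendsto (fun r => P.real (Y r ⁻¹' s)) l (𝓝 (P'.real (Z ⁻¹' s))) := by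
  rw [← Measure.map_apply_of_aemeasurable hY.aemeasurable_limit isClosed_frontier.measurableSet]
    at hfrontier
  have hlim := ProbabilityMeasure.tendsto_measure_of_null_frontier_of_tendsto' hY.tendsto hfrontier
  simp only [ProbabilityMeasure.coe_mk, Measure.map_apply_of_aemeasurable hY.aemeasurable_limit hs,
    Measure.map_apply_of_aemeasurable (hY.forall_aemeasurable _) hs] at hlim
  exact (ENNReal.tendsto_toReal (measure_ne_top _ _)).comp hlim

lemma tendsto_measureReal_abs_le_mul_sqrt {κ : Type*} {l : Filter κ} [l.IsCountablyGenerated]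
    {T : κ → Ω → ℝ} {a : κ → ℝ} {g : ℝ → ℝ} {z v : ℝ} (hv : 0 < v) (hz : 0 ≤ z)
    (hT : TendstoInDistribution T l (id : ℝ → ℝ) (fun _ => P) (gaussianReal 0 v.toNNReal))
    (ha : Tendsto a l (𝓝 0)) (hg : Continuous g) (hgv : g 0 = v) :
    Tendsto (fun r => P.real {ω | |T r ω| ≤ z * √(g (a r * T r ω))}) l
      (𝓝 (2 * cdf (gaussianReal 0 1) z - 1)) := by
  have hexcess := tendstoInDistribution_comp_prodMk_of_tendsto
    (g := fun y => |y.1| - z * √(g (y.2 * y.1))) (by fun_prop) hT ha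
  simp only [id, zero_mul, hgv] at hexcess
  have hnull :
      gaussianReal 0 v.toNNReal ((fun t => |t| - z * √v) ⁻¹' frontier (Set.Iic 0)) = 0 := by
    have := nullSingletonClass_gaussianReal (μ := 0) (v := v.toNNReal) (by simpa using hv)
    refine measure_mono_null (t := {z * √v, -(z * √v)}) (fun t ht => ?_)
      ((Set.toFinite _).measure_zero _)
    rw [frontier_Iic] at ht
    exact eq_or_eq_neg_of_abs_eq (sub_eq_zero.1 ht)
  have hlim := tendsto_measureReal_preimage_of_null_frontier hexcess measurableSet_Iic hnull
  simpa only [Set.preimage, Set.mem_Iic, sub_nonpos, gaussianReal_real_abs_le_mul_sqrt hv hz]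
    using hlim

lemma mem_fourierInterval_iff {d n : ℕ} {R z m q v : ℝ} (hn : n ≠ 0) (hR : 0 < R) :
    q ∈ fourierInterval d n R z m v ↔ |√(n / R ^ d) * (m - q)| ≤ z * √(v / π ^ d) := by
  have hscale : √(R ^ d * v / (n * π ^ d)) = √(v / π ^ d) / √(n / R ^ d) := by
    rw [← Real.sqrt_div' _ (by positivity)]
    congr 1
    field
  have hpos : 0 < √(n / R ^ d) := by positivity
  rw [fourierInterval, hscale, ← mul_div_assoc, ← Real.closedBall_eq_Icc, Metric.mem_closedBall',
    Real.dist_eq, le_div_iff₀' hpos, abs_mul, abs_of_pos hpos]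

lemma tendsto_measureReal_mem_fourierInterval {d : ℕ} {R : ℕ → ℝ} {f : ℕ → Ω → ℝ} {q z : ℝ}
    {g : ℝ → ℝ} (hR : ∀ᶠ n in atTop, 0 < R n)
    (hRn : Tendsto (fun n : ℕ => R n ^ d / n) atTop (𝓝 0)) (hq : 0 < q)
    (hclt : TendstoInDistribution (fun n ω => √(n / R n ^ d) * (f n ω - q)) atTop (id : ℝ → ℝ)
      (fun _ => P) (gaussianReal 0 (q / π ^ d).toNNReal))
    (hz : 0 ≤ z) (hg : Continuous g) (hgq : g q = q) :
    Tendsto (fun n => P.real {ω | q ∈ fourierInterval d n (R n) z (f n ω) (g (f n ω))}) atTop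
      (𝓝 (2 * cdf (gaussianReal 0 1) z - 1)) := by
  have hinv : Tendsto (fun n : ℕ => (√(n / R n ^ d))⁻¹) atTop (𝓝 0) := by
    simpa only [← Real.sqrt_inv, inv_div, Real.sqrt_zero] using hRn.sqrt
  have hlim := tendsto_measureReal_abs_le_mul_sqrt (g := fun u => g (q + u) / π ^ d)
    (by positivity) hz hclt hinv (by fun_prop) (by rw [add_zero, hgq])
  refine hlim.congr' ?_
  filter_upwards [hR, eventually_ne_atTop 0] with n hpos hn
  have hsqrt : √(n / R n ^ d) ≠ 0 := by positivity
  simp only [mem_fourierInterval_iff hn hpos, inv_mul_cancel_left₀ hsqrt, add_sub_cancel]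

end Coverage

section Supersmooth

variable {d : ℕ} {p₀ : EuclideanSpace ℝ (Fin d) → ℝ} {α K C₁ C : ℝ}
  {𝒳 : Set (EuclideanSpace ℝ (Fin d))} {Ω : Type*} [MeasurableSpace Ω] {P : Measure Ω}
  [IsProbabilityMeasure P] {X : ℕ → Ω → EuclideanSpace ℝ (Fin d)} {R : ℕ → ℝ}
  {x : EuclideanSpace ℝ (Fin d)}

lemma tendstoInDistribution_fourierEstimator (hd : 0 < d) (hp₀ : IsProbDensity p₀) (hα : 0 < α)
    (hsmooth : UpperSupersmoothWith p₀ α K C₁) (h𝒳 : 𝒳 ⊆ closure (interior 𝒳))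
    (hcont : ContinuousOn p₀ 𝒳) (hx : x ∈ 𝒳)
    (hX : ∀ i, HasLaw (X i) (volume.withDensity fun y => .ofReal (p₀ y)) P)
    (hindep : iIndepFun X P)
    (hC : 1 / (2 * C₁) < C ∨ (C = 1 / (2 * C₁) ∧ 1 - α < (d : ℝ) / 2))
    (hR : ∀ᶠ n : ℕ in atTop, 0 < R n ∧ R n ^ α = C * Real.log n) :
    TendstoInDistribution
      (fun (n : ℕ) ω => √(n / R n ^ d) * (fourierEstimator X n (R n) x ω - p₀ x))
      atTop (id : ℝ → ℝ) (fun _ => P) (gaussianReal 0 (p₀ x / π ^ d).toNNReal) := by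
  have hC0 : 0 < C := (one_div_pos.2 (mul_pos two_pos hsmooth.1)).trans_le
    (hC.elim le_of_lt (·.1.ge))
  set μ : Measure (EuclideanSpace ℝ (Fin d)) := volume.withDensity fun y => .ofReal (p₀ y)
  have : IsFiniteMeasure μ := isFiniteMeasure_withDensity_ofReal hp₀.integrable.2
  have hexp := integrable_exp_neg_mul_abs_rpow hα hsmooth.1
  have hμ (s) : ‖charFun μ s‖ ≤ K * ∏ j, Real.exp (-C₁ * |s j| ^ α) :=
    hp₀.charFun_withDensity ▸ hsmooth.norm_densityFourier_le_prod s
  have hν (s) : ‖charFun (μ.map (· + -x)) s‖ ≤ K * ∏ j, Real.exp (-C₁ * |s j| ^ α) :=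
    (norm_charFun_map_add_const μ _ s).trans_le (hμ s)
  have hinversion : ∫ s, charFun (μ.map (· + -x)) s = ((2 * π) ^ d * p₀ x : ℝ) := by
    simpa only [finrank_euclideanSpace_fin] using integral_charFun_map_neg_of_continuousOn
      hp₀.integrable hp₀.measurable hp₀.nonneg (integrable_charFun_of_norm_le_prod hexp hμ)
      h𝒳 hcont hx
  have hshift i : HasLaw (fun ω => X i ω - x) (μ.map (· + -x)) P := by
    simpa only [sub_eq_add_neg] using
      HasLaw.fun_comp (Y := (· + -x)) ⟨by fun_prop, rfl⟩ (hX i)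
  exact tendstoInDistribution_fourierEstimator_of_bias hd hshift hindep
    (integrable_charFun_of_norm_le_prod hexp hν) hinversion (tendsto_radius hα hC0 hR)
    (tendsto_radius_pow_div_natCast hα hC0 hR)
    (tendsto_sqrt_natCast_div_pow_mul_bias hα hsmooth.1 hν hinversion hC hR)

theorem proposition2_general (hd : 0 < d) (hp₀ : IsProbDensity p₀) (hα : 0 < α)
    (hsmooth : UpperSupersmoothWith p₀ α K C₁) (h𝒳 : 𝒳 ⊆ closure (interior 𝒳))
    (hcont : ContinuousOn p₀ 𝒳) (hx : x ∈ 𝒳)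
    (hX : ∀ i, HasLaw (X i) (volume.withDensity fun y => .ofReal (p₀ y)) P)
    (hindep : iIndepFun X P)
    (hC : 1 / (2 * C₁) < C ∨ (C = 1 / (2 * C₁) ∧ 1 - α < (d : ℝ) / 2))
    (hR : ∀ᶠ n : ℕ in atTop, 0 < R n ∧ R n ^ α = C * Real.log n) :
    TendstoInDistribution
      (fun (n : ℕ) ω => √(n / R n ^ d) * (fourierEstimator X n (R n) x ω - p₀ x))
      atTop (id : ℝ → ℝ) (fun _ => P) (gaussianReal 0 (p₀ x / π ^ d).toNNReal) ∧
    (0 < p₀ x → ∀ τ < 1, ∀ z, cdf (gaussianReal 0 1) z = 1 - τ / 2 →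
      Tendsto (fun n : ℕ => P.real {ω | p₀ x ∈
          fourierInterval d n (R n) z (fourierEstimator X n (R n) x ω) (p₀ x)})
        atTop (𝓝 (1 - τ)) ∧
      Tendsto (fun n : ℕ => P.real {ω | p₀ x ∈
          fourierInterval d n (R n) z (fourierEstimator X n (R n) x ω)
            (max (fourierEstimator X n (R n) x ω) 0)})
        atTop (𝓝 (1 - τ))) := by
  have hC0 : 0 < C := (one_div_pos.2 (mul_pos two_pos hsmooth.1)).trans_le
    (hC.elim le_of_lt (·.1.ge))
  have hclt := tendstoInDistribution_fourierEstimator hd hp₀ hα hsmooth h𝒳 hcont hx hX hindep hC hR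
  refine ⟨hclt, fun hpos τ hτ z hz => ?_⟩
  have hz0 : 0 ≤ z := nonneg_of_one_half_lt_cdf (gaussianReal_zero_map_neg 1) (by linarith)
  have hlevel : 1 - τ = 2 * cdf (gaussianReal 0 1) z - 1 := by linarith
  have hcoverage {g : ℝ → ℝ} := tendsto_measureReal_mem_fourierInterval (g := g)
    (hR.mono fun _ => And.left) (tendsto_radius_pow_div_natCast hα hC0 hR) hpos hclt hz0
  rw [hlevel]
  exact ⟨hcoverage (g := fun _ => p₀ x) continuous_const rfl,
    hcoverage (g := (max · 0)) (by fun_prop) (max_eq_left hpos.le)⟩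

end Supersmooth

theorem proposition2 {d : ℕ} (hd : 0 < d)
    (p₀ : EuclideanSpace ℝ (Fin d) → ℝ) (hp₀ : IsProbDensity p₀)
    (α K C₁ : ℝ) (hα : 0 < α) (hsmooth : UpperSupersmoothWith p₀ α K C₁)
    (𝒳 : Set (EuclideanSpace ℝ (Fin d))) (h𝒳 : Bornology.IsBounded 𝒳)
    (h𝒳reg : 𝒳 ⊆ closure (interior 𝒳)) (hC1 : ContDiffOn ℝ 1 p₀ 𝒳)
    {Ω : Type*} [MeasurableSpace Ω] (P : Measure Ω) [IsProbabilityMeasure P]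
    (X : ℕ → Ω → EuclideanSpace ℝ (Fin d)) (hX : ∀ i, Measurable (X i))
    (hindep : iIndepFun X P)
    (hlaw : ∀ i, P.map (X i) = volume.withDensity (fun x => ENNReal.ofReal (p₀ x)))
    (C : ℝ) (hC : 1 / (2 * C₁) < C ∨ (C = 1 / (2 * C₁) ∧ 1 - α < (d : ℝ) / 2))
    (R : ℕ → ℝ) (hR : ∀ n : ℕ, 2 ≤ n → 0 < R n ∧ R n ^ α = C * Real.log n)
    (x : EuclideanSpace ℝ (Fin d)) (hx : x ∈ 𝒳) :
    TendstoInDistribution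
      (fun (n : ℕ) (ω : Ω) =>
        Real.sqrt ((n : ℝ) / R n ^ d) * (fourierEstimator X n (R n) x ω - p₀ x))
      atTop (id : ℝ → ℝ) (fun _ => P)
      (gaussianReal 0 (p₀ x / Real.pi ^ d).toNNReal) ∧
    (0 < p₀ x → ∀ τ : ℝ, 0 < τ → τ < 1 →
      ∀ z : ℝ, cdf (gaussianReal 0 1) z = 1 - τ / 2 →
        Tendsto (fun n : ℕ => P.real {ω | p₀ x ∈
            fourierInterval d n (R n) z (fourierEstimator X n (R n) x ω) (p₀ x)})
          atTop (𝓝 (1 - τ)) ∧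
        Tendsto (fun n : ℕ => P.real {ω | p₀ x ∈
            fourierInterval d n (R n) z (fourierEstimator X n (R n) x ω)
              (max (fourierEstimator X n (R n) x ω) 0)})
          atTop (𝓝 (1 - τ))) :=
  (proposition2_general hd hp₀ hα hsmooth h𝒳reg hC1.continuousOn hx
    (fun i => ⟨(hX i).aemeasurable, hlaw i⟩) hindep hC (eventually_atTop.2 ⟨2, hR⟩)).imp_right
    fun hcoverage hpos τ _ => hcoverage hpos τ
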